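/- Let $p$ be an odd prime, $q$ a power of $p$, $\mathbb F_q$ the finite field with $q$ elements, and let $k\ge 0$ be an integer. For $n\ge 1$ let $$D_{n,k}(a,x)=\sum_{i=0}^{\lfloor n/2\rfloor}\frac{n-ki}{n-i}\binom{n-i}{i}(-x)^i a^{n-2i}$$ (the coefficients $\frac{n-ki}{n-i}\binom{n-i}{i}$ are integers, read in $\mathbb F_q$), and $D_{0,k}(a,x)=2-k$, be the $n$-th reversed Dickson polynomial of the $(k+1)$-th kind. Put $\mathcal D_n=\sum_{a\in\mathbb F_q}D_{n,k}(1,a)\in\mathbb F_q$. In $\mathbb F_q[z]$ set $$B(z)=\bigl(2-k+(k-1)z\bigr)\bigl(-1-(z-z^q)^{q-1}\bigr)$$ and $$R(z)=(1+z^{q-1}-z^q)\sum_{i=1}^{q^2-1}z^i-\Bigl(z^{2(q-1)}+\sum_{m=1}^{q-1}(z-1)^{q-1-m}z^{2m}\bigl(\tfrac14\bigr)^m\Bigr)B(z),$$ and let $c_j$ be the coefficient of $z^j$ in $R(z)$. Then $R(z)=\sum_{i=1}^{q^2+q-1}c_iz^i$, and the following identities hold in $\mathbb F_q$: 1. $\mathcal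 D_j=-c_j+\dfrac{k(j-1)+2}{2^j}$ for $1\le j\le q-1$; 2. $\mathcal D_q=c_1-c_q+\dfrac{2-k}{2^q}$; 3. $\mathcal D_{lq+j}=\mathcal D_{(l-1)q+j}-\mathcal D_{(l-1)q+j+1}-c_{lq+j}+\dfrac{(kj+2)(1-2^q+2^{q-1})+k(2^q-1)}{2^{lq+j}}$ for $1\le l\le q-2$ and $1\le j\le q-1$; 4. $\mathcal D_{lq}=\mathcal D_{(l-1)q}-\mathcal D_{(l-1)q+1}-c_{lq}+\dfrac{(k-2)(2^q-1)+2^q}{2^{lq}}$ for $2\le l\le q-2$; 5. $\mathcal D_{q^2-q+j}=\displaystyle\sum_{i=j}^{q-1}c_{q^2+i}+\dfrac{k(j-1)+2}{2^{q^2-q+j}}$ for $0\le j\le q-1$. -/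

import Mathlib

open Polynomial

/-- The integer `(n - k i) / (n - i) * binom (n - i) i`, for `0 < n` and `i ≤ n / 2`.
The division of integers is exact, see `rdCoeff_cast`. -/
def rdCoeff (n k i : ℕ) : ℤ :=
  (((n : ℤ) - k * i) * ((n - i).choose i : ℤ)) / ((n : ℤ) - i)

theorem rdCoeff_dvd (n k i : ℕ) (hn : 0 < n) (hi : i ≤ n / 2) :
    ((n : ℤ) - i) ∣ ((n : ℤ) - k * i) * ((n - i).choose i : ℤ) := by
  obtain ⟨m, rfl⟩ : ∃ m, n = m + 1 + i := ⟨n - i - 1, by omega⟩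
  rcases i with _ | i
  · simp
  · have h := Nat.add_one_mul_choose_eq m i
    have h' : ((m : ℤ) + 1) * (m.choose i : ℤ) = ((m + 1).choose (i + 1) : ℤ) * (i + 1) := by
      exact_mod_cast h
    have e : m + 1 + (i + 1) - (i + 1) = m + 1 := by omega
    rw [e]
    refine ⟨((m + 1).choose (i + 1) : ℤ) - (k - 1) * (m.choose i : ℤ), ?_⟩
    push_cast
    linear_combination ((k : ℤ) - 1) * h'

theorem rdCoeff_cast (n k i : ℕ) (hn : 0 < n) (hi : i ≤ n / 2) :
    (rdCoeff n k i : ℚ) = ((n : ℚ) - k * i) / ((n : ℚ) - i) * ((n - i).choose i : ℚ) := by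
  have hne : ((n : ℤ) - i) ≠ 0 := by omega
  have hne' : (((n : ℤ) - i : ℤ) : ℚ) ≠ 0 := by exact_mod_cast hne
  rw [rdCoeff, Int.cast_div (rdCoeff_dvd n k i hn hi) hne']
  push_cast
  ring

/-- The `n`-th reversed Dickson polynomial of the `(k+1)`-th kind `D_{n,k}(a, x)`, as a polynomial
in `x` with parameter `a`. -/
noncomputable def reversedDickson {F : Type*} [CommRing F] (n k : ℕ) (a : F) : F[X] :=
  if n = 0 then C (2 - (k : F))
  else ∑ i ∈ Finset.range (n / 2 + 1), C ((rdCoeff n k i : ℤ) : F) * (-X) ^ i * C (a ^ (n - 2 * i))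

/-- The sum of `D_{n,k}(1, a)` over all `a` in the finite field `F`. -/
noncomputable def dicksonSum (F : Type*) [Field F] [Fintype F] (n k : ℕ) : F :=
  ∑ a : F, (reversedDickson n k (1 : F)).eval a

/-- `∑ b_j z^j = (2 - k + (k - 1) z) (-1 - (z - z^q)^(q-1))`. -/
noncomputable def bPoly (F : Type*) [Field F] (q k : ℕ) : F[X] :=
  (C (2 - (k : F)) + C ((k : F) - 1) * X) * (-1 - (X - X ^ q) ^ (q - 1))

/-- The polynomial `∑ c_i z^i`, that is
`(1 + z^(q-1) - z^q) ∑_{i=1}^{q^2-1} z^i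
  - (z^(2(q-1)) + ∑_{m=1}^{q-1} (z-1)^(q-1-m) z^(2m) (1/4)^m) ∑ b_j z^j`. -/
noncomputable def cPoly (F : Type*) [Field F] (q k : ℕ) : F[X] :=
  (1 + X ^ (q - 1) - X ^ q) * (∑ i ∈ Finset.Icc 1 (q ^ 2 - 1), X ^ i)
    - (X ^ (2 * (q - 1))
        + ∑ m ∈ Finset.Icc 1 (q - 1), (X - 1) ^ (q - 1 - m) * X ^ (2 * m) * C ((1 / 4 : F) ^ m))
      * bPoly F q k

/-- The coefficient `c_j`. -/
noncomputable def cCoeff (F : Type*) [Field F] (q k j : ℕ) : F :=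
  (cPoly F q k).coeff j

/-! For fixed `a`, the values `D_n = D_{n,k}(1,a)` satisfy `D_{n+2} = D_{n+1} - a D_n`. If `a` is
neither 0 nor 1/4, the characteristic roots `y`, `1 - y` are distinct, nonzero and fixed by
`q^2`-Frobenius, so the sequence has period `q^2 - 1`. The generating function cut at `q^2 - 1` is
then `1 - z^(q^2-1)` times an explicit fraction with denominator `1 - z + a z^2` (`sum_period_eq`,
where `a = 0` is also covered). The sum of `1/(1 - z + a z^2)` over all `a` is a logarithmic
derivative of `T^q - T` (`sum_inv_quadratic`). Removing `a = 1/4` and clearing `z^q - z^(q-1) - 1`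
gives `cPoly_eq`. Comparing coefficients and restoring the explicit value at `1/4` yields the five
identities. -/

/-! ### Recurrence and truncated generating function. -/

section FibonacciSums

variable {R : Type*} [CommRing R]

/-- The sum `∑ binom (n - i) i (-a)^i`, i.e. the case `k = 1` of the reversed Dickson values. -/
def chooseSum (a : R) (n : ℕ) : R :=
  ∑ i ∈ Finset.range (n + 1), ((n - i).choose i : R) * (-a) ^ i

/-- Pascal's rule along the shallow diagonals, as for Fibonacci numbers. -/
theorem chooseSum_add_two (a : R) (n : ℕ) :
    chooseSum a (n + 2) = chooseSum a (n + 1) - a * chooseSum a n := by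
  have h1 : chooseSum a (n + 2) = ∑ i ∈ Finset.range (n + 1),
      ((n - i).choose i + (n - i).choose (i + 1) : R) * (-a) ^ (i + 1) + 1 := by
    rw [chooseSum, Finset.sum_range_succ', Finset.sum_range_succ]
    have h0 : n + 2 - (n + 1 + 1) = 0 := by omega
    simp only [h0, Nat.choose_zero_succ, Nat.cast_zero, zero_mul, add_zero, pow_zero, mul_one,
      Nat.choose_zero_right, Nat.cast_one]
    congr 1
    refine Finset.sum_congr rfl fun i hi => ?_
    have hi' : n + 2 - (i + 1) = n - i + 1 := by
      have := Finset.mem_range.1 hi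
      omega
    rw [hi', Nat.choose_succ_succ]
    push_cast
    ring
  have h2 : chooseSum a (n + 1) = ∑ i ∈ Finset.range (n + 1),
      ((n - i).choose (i + 1) : R) * (-a) ^ (i + 1) + 1 := by
    rw [chooseSum, Finset.sum_range_succ']
    congr 1
    · refine Finset.sum_congr rfl fun i hi => ?_
      rw [Nat.add_sub_add_right]
    · simp
  rw [h1, h2, chooseSum, Finset.mul_sum, add_sub_right_comm, ← Finset.sum_sub_distrib]
  congr 1
  exact Finset.sum_congr rfl fun i _ => by ring

/-- Split `n+1-ki = (2-k)(n+1-i) + (k-1)(n+1-2i)` and absorb `n+1-2i` into the binomial. No division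
is left, so the formula can be read in any ring. -/
theorem rdCoeff_succ (n k i : ℕ) (hi : i ≤ (n + 1) / 2) :
    rdCoeff (n + 1) k i =
      (2 - k) * ((n + 1 - i).choose i : ℤ) + (k - 1) * ((n - i).choose i : ℤ) := by
  have hne : ((n + 1 : ℕ) : ℤ) - i ≠ 0 := by omega
  refine Int.ediv_eq_of_eq_mul_right hne ?_
  have hni : n + 1 - i = n - i + 1 := by omega
  have h := Nat.choose_mul_succ_eq (n - i) i
  rw [hni]
  have e1 : ((n - i : ℕ) : ℤ) = n - i := by omega
  have e2 : ((n - i + 1 - i : ℕ) : ℤ) = n + 1 - 2 * i := by omega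
  have h' : ((n - i).choose i : ℤ) * (n - i + 1) =
      ((n - i + 1).choose i : ℤ) * (n + 1 - 2 * i) := by
    rw [← e1, ← e2]
    exact_mod_cast h
  push_cast
  linear_combination -((k : ℤ) - 1) * h'

theorem eval_reversedDickson_succ (n k : ℕ) (a : R) :
    (reversedDickson (n + 1) k (1 : R)).eval a =
      (2 - k) * chooseSum a (n + 1) + (k - 1) * chooseSum a n := by
  have hf : ∀ m t, m / 2 + 1 ≤ t → chooseSum a m =
      ∑ i ∈ Finset.range t, ((m - i).choose i : R) * (-a) ^ i := by
    have key : ∀ m t, m / 2 + 1 ≤ t → ∑ i ∈ Finset.range (m / 2 + 1),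
        ((m - i).choose i : R) * (-a) ^ i =
        ∑ i ∈ Finset.range t, ((m - i).choose i : R) * (-a) ^ i := by
      intro m t ht
      refine Finset.sum_subset (Finset.range_mono ht) fun i _ hi => ?_
      rw [Finset.mem_range, not_lt] at hi
      rw [Nat.choose_eq_zero_of_lt (by omega), Nat.cast_zero, zero_mul]
    intro m t ht
    rw [← key m t ht, key m (m + 1) (by omega), chooseSum]
  rw [hf (n + 1) ((n + 1) / 2 + 1) le_rfl, hf n ((n + 1) / 2 + 1) (by omega), Finset.mul_sum,
    Finset.mul_sum, ← Finset.sum_add_distrib, reversedDickson, if_neg (Nat.succ_ne_zero n),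
    eval_finsetSum]
  refine Finset.sum_congr rfl fun i hi => ?_
  rw [rdCoeff_succ n k i (by have := Finset.mem_range.1 hi; omega)]
  simp only [eval_mul, eval_C, eval_pow, eval_neg, eval_X, one_pow]
  push_cast
  ring

theorem eval_reversedDickson_zero (k : ℕ) (a : R) :
    (reversedDickson 0 k (1 : R)).eval a = 2 - k := by
  simp [reversedDickson]

theorem eval_reversedDickson_one (k : ℕ) (a : R) :
    (reversedDickson 1 k (1 : R)).eval a = 1 := by
  rw [eval_reversedDickson_succ]
  simp [chooseSum, Finset.sum_range_succ]
  ring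

theorem eval_reversedDickson_add_two (n k : ℕ) (a : R) :
    (reversedDickson (n + 2) k (1 : R)).eval a =
      (reversedDickson (n + 1) k (1 : R)).eval a - a * (reversedDickson n k (1 : R)).eval a := by
  rcases n with _ | n
  · rw [eval_reversedDickson_one, eval_reversedDickson_zero, eval_reversedDickson_succ]
    simp [chooseSum, Finset.sum_range_succ]
    ring
  · rw [eval_reversedDickson_succ (n + 2), eval_reversedDickson_succ (n + 1),
      eval_reversedDickson_succ n, chooseSum_add_two a (n + 1), chooseSum_add_two a n]
    ring

/-- The truncated generating function of `D_{n,k}(1, a)`, multiplied by `1 - X + a X^2`. -/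
theorem truncated_generating_function (k : ℕ) (a : R) (N : ℕ) :
    (1 - X + C a * X ^ 2) *
        ∑ n ∈ Finset.Icc 1 N, C ((reversedDickson n k (1 : R)).eval a) * X ^ n =
      X - C (a * (2 - k)) * X ^ 2 - C ((reversedDickson (N + 1) k (1 : R)).eval a) * X ^ (N + 1)
        + C (a * (reversedDickson N k (1 : R)).eval a) * X ^ (N + 2) := by
  induction N with
  | zero => simp [eval_reversedDickson_zero, eval_reversedDickson_one]
  | succ N ih =>
    rw [Finset.sum_Icc_succ_top (by omega), mul_add, ih, eval_reversedDickson_add_two]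
    simp only [C_sub, C_mul]
    ring

end FibonacciSums

/-! ### Periodicity, summation over the field, and the factorization. -/

section FiniteField

variable {F : Type*} [Field F]

theorem sub_pow_card [Fintype F] {A : Type*} [CommRing A] [Algebra F A] (x y : A) :
    (x - y) ^ Fintype.card F = x ^ Fintype.card F - y ^ Fintype.card F :=
  map_sub (FiniteField.frobeniusAlgHom F A) x y

theorem algebraMap_pow_card [Fintype F] {A : Type*} [CommRing A] [Algebra F A] (a : F) :
    algebraMap F A a ^ Fintype.card F = algebraMap F A a := by
  rw [← map_pow, FiniteField.pow_card]

/-- Both roots `y`, `1 - y` of `Y^2 - Y + a` lie in the quadratic extension of `F`. -/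
theorem pow_card_sq_eq_self [Fintype F] {K : Type*} [Field K] [Algebra F K] {a : F} {y : K}
    (hy : y * (1 - y) = algebraMap F K a) : y ^ Fintype.card F ^ 2 = y := by
  have h : y ^ Fintype.card F * (1 - y ^ Fintype.card F) = y * (1 - y) := by
    have := congrArg (· ^ Fintype.card F) hy
    simp only [mul_pow, sub_pow_card (F := F), one_pow, algebraMap_pow_card] at this
    rw [this, hy]
  have h' : (y ^ Fintype.card F - y) * (y ^ Fintype.card F - (1 - y)) = 0 := by
    linear_combination -h
  rw [sq, pow_mul]
  rcases mul_eq_zero.1 h' with h' | h' <;> rw [sub_eq_zero.1 h']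
  · exact sub_eq_zero.1 h'
  · rw [sub_pow_card (F := F), sub_eq_zero.1 h', one_pow, sub_sub_cancel]

/-- Both sides obey the recurrence with roots `y`, `1 - y`. Keeping the factor `2y - 1` avoids
excluding the double root. -/
theorem eval_reversedDickson_binet {K : Type*} [Field K] [Algebra F K] (k : ℕ) {a : F} {y : K}
    (hy : y * (1 - y) = algebraMap F K a) (n : ℕ) :
    (2 * y - 1) * algebraMap F K ((reversedDickson n k (1 : F)).eval a) =
      (1 - (2 - k) * (1 - y)) * y ^ n + ((2 - k) * y - 1) * (1 - y) ^ n := by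
  induction n using Nat.twoStepInduction with
  | zero =>
    rw [eval_reversedDickson_zero]
    simp only [map_sub, map_natCast, map_ofNat]
    ring
  | one =>
    rw [eval_reversedDickson_one, map_one]
    ring
  | more n h0 h1 =>
    rw [eval_reversedDickson_add_two, map_sub, map_mul, ← hy]
    linear_combination h1 - y * (1 - y) * h0

/-- Away from the double root `a = 1/4`, the values have period `q^2 - 1`. -/
theorem eval_reversedDickson_add_period [Fintype F] (k : ℕ) {a : F} (ha : a ≠ 0) (ha4 : 4 * a ≠ 1) (n : ℕ) :
    (reversedDickson (n + (Fintype.card F ^ 2 - 1)) k (1 : F)).eval a =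
      (reversedDickson n k (1 : F)).eval a := by
  let K := AlgebraicClosure F
  obtain ⟨y, hy⟩ : ∃ y : K, y * (1 - y) = algebraMap F K a := by
    obtain ⟨y, hy⟩ := IsAlgClosed.exists_root (X ^ 2 - X + C (algebraMap F K a)) (by
      have : (X ^ 2 - X + C (algebraMap F K a)).degree = 2 := by compute_degree!
      rw [this]; decide)
    refine ⟨y, ?_⟩
    simp only [IsRoot, eval_add, eval_sub, eval_pow, eval_X, eval_C] at hy
    linear_combination -hy
  have hy' : (1 - y) * (1 - (1 - y)) = algebraMap F K a := by rw [← hy]; ring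
  have hinj : Function.Injective (algebraMap F K) := (algebraMap F K).injective
  have ha' : y * (1 - y) ≠ 0 := by
    rw [hy]
    exact (_root_.map_ne_zero _).2 ha
  have hd : 2 * y - 1 ≠ 0 := by
    intro h
    apply ha4
    apply hinj
    rw [map_mul, map_one, map_ofNat, ← hy]
    linear_combination -(2 * y - 1) * h
  have hq : Fintype.card F ^ 2 = Fintype.card F ^ 2 - 1 + 1 :=
    (Nat.sub_add_cancel (Nat.one_le_pow _ _ Fintype.card_pos)).symm
  have hper : ∀ z : K, z ≠ 0 → z ^ Fintype.card F ^ 2 = z → z ^ (Fintype.card F ^ 2 - 1) = 1 := by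
    intro z hz h
    rw [hq, pow_succ] at h
    exact mul_right_cancel₀ hz (by rw [h, one_mul])
  apply hinj
  apply mul_left_cancel₀ hd
  rw [eval_reversedDickson_binet k hy, eval_reversedDickson_binet k hy, pow_add, pow_add,
    hper y (left_ne_zero_of_mul ha') (pow_card_sq_eq_self hy),
    hper (1 - y) (right_ne_zero_of_mul ha') (pow_card_sq_eq_self hy'), mul_one, mul_one]

theorem eval_reversedDickson_zero_arg (k n : ℕ) (hn : n ≠ 0) :
    (reversedDickson n k (1 : F)).eval 0 = 1 := by
  induction n using Nat.twoStepInduction with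
  | zero => exact absurd rfl hn
  | one => exact eval_reversedDickson_one k 0
  | more n _ h => rw [eval_reversedDickson_add_two, h (Nat.succ_ne_zero n), zero_mul, sub_zero]

theorem eval_reversedDickson_quarter (h2 : (2 : F) ≠ 0) (k n : ℕ) :
    (reversedDickson n k (1 : F)).eval (1 / 4) = ((k : F) * ((n : F) - 1) + 2) / 2 ^ n := by
  have h4 : (4 : F) = 2 * 2 := by norm_num
  induction n using Nat.twoStepInduction with
  | zero => rw [eval_reversedDickson_zero]; push_cast; ring
  | one => rw [eval_reversedDickson_one]; push_cast; field_simp; ring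
  | more n h0 h1 =>
    rw [eval_reversedDickson_add_two, h0, h1, h4]
    push_cast
    field_simp
    ring

/-- The polynomial identity behind the summation over one `a ≠ 1/4`. -/
theorem sum_period_eq [Fintype F] (k : ℕ) {a : F} (ha4 : 4 * a ≠ 1) :
    (1 - X + C a * X ^ 2) * ∑ n ∈ Finset.Icc 1 (Fintype.card F ^ 2 - 1),
        C ((reversedDickson n k (1 : F)).eval a) * X ^ n =
      (1 - X ^ (Fintype.card F ^ 2 - 1)) *
        (C (2 - (k : F)) + C ((k : F) - 1) * X - C (2 - (k : F)) * (1 - X + C a * X ^ 2)) := by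
  rw [truncated_generating_function]
  have hN : (reversedDickson (Fintype.card F ^ 2 - 1 + 1) k (1 : F)).eval a = 1 ∧
      a * (reversedDickson (Fintype.card F ^ 2 - 1) k (1 : F)).eval a = a * (2 - k) := by
    -- At `a = 0` the values are 1 for `n ≥ 1` but `2 - k` at `n = 0`, so periodicity can fail
    -- there; the second boundary term survives because it carries the factor `a`.
    by_cases ha : a = 0
    · subst ha
      exact ⟨eval_reversedDickson_zero_arg k _ (Nat.succ_ne_zero _), by simp⟩
    · have h0 := eval_reversedDickson_add_period k ha ha4 0
      have h1 := eval_reversedDickson_add_period k ha ha4 1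
      rw [zero_add, eval_reversedDickson_zero] at h0
      rw [add_comm, eval_reversedDickson_one] at h1
      exact ⟨h1, by rw [h0]⟩
  rw [hN.1, hN.2]
  simp only [C_sub, C_mul, C_1, map_ofNat]
  ring

/-- The logarithmic derivative of `T^q - T`. -/
theorem sum_inv_add_algebraMap [Fintype F] {K : Type*} [Field K] [Algebra F K] (t : K)
    (ht : ∀ a : F, t + algebraMap F K a ≠ 0) :
    ∑ a : F, (t + algebraMap F K a)⁻¹ = -(t ^ Fintype.card F - t)⁻¹ ∧
      t ^ Fintype.card F - t ≠ 0 := by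
  set q := Fintype.card F with hq
  have hroots : (X ^ q - X : F[X]).roots = Finset.univ.val := FiniteField.roots_X_pow_card_sub_X F
  have hsplit : (X ^ q - X : F[X]).Splits := by
    rw [splits_iff_card_roots, hroots,
      FiniteField.X_pow_card_sub_X_natDegree_eq F Fintype.one_lt_card, ← Finset.card_def,
      Finset.card_univ]
  have hmap : map (algebraMap F K) (X ^ q - X) = X ^ q - X := by simp
  have heval : (X ^ q - X : K[X]).eval t = t ^ q - t := by simp
  have hrootsK := hsplit.roots_map (algebraMap F K)
  have hne : t ^ q - t ≠ 0 := by
    intro h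
    have hmem : t ∈ (X ^ q - X : K[X]).roots :=
      (mem_roots (FiniteField.X_pow_card_sub_X_ne_zero K Fintype.one_lt_card)).2
        (by rw [IsRoot, heval, h])
    rw [← hmap, hrootsK, Multiset.mem_map] at hmem
    obtain ⟨a, -, rfl⟩ := hmem
    exact ht (-a) (by rw [map_neg, add_neg_cancel])
  refine ⟨?_, hne⟩
  have hcard : (q : K) = 0 := by
    rw [← map_natCast (algebraMap F K), hq, FiniteField.cast_card_eq_zero, map_zero]
  have hder := (hsplit.map (algebraMap F K)).eval_derivative_div_eval_of_ne_zero (x := t)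
    (by rwa [hmap, heval])
  rw [hrootsK, hroots, hmap, heval, Multiset.map_map] at hder
  simp only [derivative_sub, derivative_X_pow, derivative_X, hcard, C_0, zero_mul, zero_sub,
    eval_neg, eval_one] at hder
  -- The derivative of `X^q - X` is `-1`; the sum over roots has terms `1/(t - a)`, hence the
  -- reindexing by negation.
  rw [inv_eq_one_div, ← neg_div, hder, ← Equiv.sum_comp (Equiv.neg F)]
  change _ = ∑ a : F, _
  refine Finset.sum_congr rfl fun a _ => ?_
  simp [sub_eq_add_neg]

theorem one_sub_X_mul_sum_pow (N : ℕ) :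
    (1 - X : F[X]) * ∑ i ∈ Finset.Icc 1 N, X ^ i = X * (1 - X ^ N) := by
  induction N with
  | zero => simp
  | succ N ih =>
    rw [Finset.sum_Icc_succ_top (by omega), mul_add, ih]
    ring

/-- Frobenius gives `(X - X^q)^q = X^q - X^(q^2)`; cancel one factor `X`. -/
theorem one_sub_X_pow_mul_bPoly [Fintype F] (k : ℕ) :
    (1 - X ^ (Fintype.card F - 1)) * bPoly F (Fintype.card F) k =
      -((C (2 - (k : F)) + C ((k : F) - 1) * X) * (1 - X ^ (Fintype.card F ^ 2 - 1))) := by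
  obtain ⟨r, hr⟩ : ∃ r, Fintype.card F = r + 1 := ⟨_, (Nat.sub_add_cancel Fintype.card_pos).symm⟩
  have h := sub_pow_card (F := F) (X : F[X]) (X ^ Fintype.card F)
  rw [← pow_mul, ← sq] at h
  obtain ⟨N, hN⟩ : ∃ N, Fintype.card F ^ 2 = N + 1 :=
    ⟨_, (Nat.sub_add_cancel (Nat.one_le_pow _ _ Fintype.card_pos)).symm⟩
  rw [hN] at h
  rw [bPoly, hN, hr, Nat.add_sub_cancel, Nat.add_sub_cancel]
  rw [hr] at h
  apply mul_left_cancel₀ (X_ne_zero (R := F))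
  rw [pow_succ] at h
  linear_combination -(C (2 - (k : F)) + C ((k : F) - 1) * X) * h

/-- A geometric sum in `X^2/4` and `X - 1`, whose difference is the quadratic at `a = 1/4`;
Frobenius evaluates the difference of `q`-th powers. -/
theorem quarter_geom_sum [Fintype F] :
    (1 - X + C (1 / 4 : F) * X ^ 2) *
        ((∑ m ∈ Finset.Icc 1 (Fintype.card F - 1),
          (X - 1) ^ (Fintype.card F - 1 - m) * X ^ (2 * m) * C ((1 / 4 : F) ^ m))
          + (X - 1) ^ (Fintype.card F - 1)) =
      1 - X ^ Fintype.card F + C (1 / 4 : F) * (X ^ Fintype.card F) ^ 2 := by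
  have h := (Commute.all (C (1 / 4 : F) * X ^ 2) (X - 1)).mul_geom_sum₂ (Fintype.card F)
  have hsum : ∑ i ∈ Finset.range (Fintype.card F),
      (C (1 / 4 : F) * X ^ 2) ^ i * (X - 1) ^ (Fintype.card F - 1 - i) =
      (∑ m ∈ Finset.Icc 1 (Fintype.card F - 1),
          (X - 1) ^ (Fintype.card F - 1 - m) * X ^ (2 * m) * C ((1 / 4 : F) ^ m))
          + (X - 1) ^ (Fintype.card F - 1) := by
    have hr : Finset.range (Fintype.card F) = insert 0 (Finset.Icc 1 (Fintype.card F - 1)) := by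
      ext i
      have := Fintype.card_pos (α := F)
      simp only [Finset.mem_range, Finset.mem_insert, Finset.mem_Icc]
      omega
    rw [hr, Finset.sum_insert (by simp), add_comm]
    congr 1
    · refine Finset.sum_congr rfl fun m _ => ?_
      rw [mul_pow, ← C_pow, ← pow_mul]
      ring
    · simp
  rw [hsum, sub_pow_card (F := F), one_pow, mul_pow, ← C_pow, FiniteField.pow_card,
    ← pow_mul, mul_comm 2, pow_mul] at h
  linear_combination h

/-- The sum of `1 / (1 - x + a x^2)` over the finite field. -/
theorem sum_inv_quadratic [Fintype F] {K : Type*} [Field K] [Algebra F K] {x y : K} (hx : x ≠ 0)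
    (hxy : x ^ Fintype.card F = x * y) (hw : ∀ a : F, 1 - x + algebraMap F K a * x ^ 2 ≠ 0) :
    ∑ a : F, (1 - x + algebraMap F K a * x ^ 2)⁻¹ =
        -(y ^ 2 / ((1 - y) * (1 + y - x * y))) ∧ (1 - y) * (1 + y - x * y) ≠ 0 := by
  have hy : y ≠ 0 := by
    rintro rfl
    rw [mul_zero] at hxy
    exact pow_ne_zero _ hx hxy
  have hw' : ∀ a : F, 1 - x + algebraMap F K a * x ^ 2 =
      ((1 - x) / x ^ 2 + algebraMap F K a) * x ^ 2 := fun a => by field_simp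
  obtain ⟨h, hne⟩ := sum_inv_add_algebraMap (F := F) ((1 - x) / x ^ 2) fun a h0 =>
    hw a (by rw [hw', h0, zero_mul])
  have ht : ((1 - x) / x ^ 2) ^ Fintype.card F - (1 - x) / x ^ 2 =
      (1 - y) * (1 + y - x * y) / (x * y) ^ 2 := by
    rw [div_pow, sub_pow_card (F := F), one_pow, ← pow_mul, mul_comm 2, pow_mul, hxy]
    field_simp
    ring
  rw [ht] at h hne
  refine ⟨?_, (div_ne_zero_iff.1 hne).1⟩
  simp only [hw', mul_inv]
  rw [← Finset.sum_mul, h]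
  have := (div_ne_zero_iff.1 hne).1
  rw [inv_div, mul_pow]
  field_simp

/-- The factorization of `cPoly` after an embedding of `F[X]` into a field, where it reduces to a
computation with fractions. -/
theorem map_cPoly_eq [Fintype F] [DecidableEq F] (h4 : (4 : F) ≠ 0) (k : ℕ) {K : Type*} [Field K]
    [Algebra F K] (φ : F[X] →+* K) (hφ : Function.Injective φ)
    (hC : ∀ a : F, φ (C a) = algebraMap F K a) :
    φ (cPoly F (Fintype.card F) k) = φ ((X ^ Fintype.card F - X ^ (Fintype.card F - 1) - 1) *
      ∑ a ∈ Finset.univ.erase (1 / 4 : F), ∑ n ∈ Finset.Icc 1 (Fintype.card F ^ 2 - 1),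
        C ((reversedDickson n k (1 : F)).eval a) * X ^ n) := by
  set q := Fintype.card F with hq
  set N := q ^ 2 - 1 with hN
  -- A nonzero constant term makes each denominator `1 - x + a x^2` invertible in `K`.
  have hne : ∀ p : F[X], p.eval 0 ≠ 0 → φ p ≠ 0 := by
    intro p hp h
    rw [← map_zero φ] at h
    rw [hφ h, eval_zero] at hp
    exact hp rfl
  have hx : φ X ≠ 0 := fun h => X_ne_zero (hφ (h.trans (map_zero φ).symm))
  have hw : ∀ a : F, 1 - φ X + algebraMap F K a * φ X ^ 2 ≠ 0 := by
    intro a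
    have := hne (1 - X + C a * X ^ 2) (by simp)
    simpa only [map_add, map_sub, map_one, map_mul, map_pow, hC] using this
  have hx1 : 1 - φ X ≠ 0 := by
    simpa only [_root_.map_zero, zero_mul, add_zero] using hw 0
  have hqr : q = q - 1 + 1 := (Nat.sub_add_cancel Fintype.card_pos).symm
  have hxy : φ X ^ q = φ X * φ X ^ (q - 1) := by
    conv_lhs => rw [hqr, pow_succ']
  obtain ⟨hS, hP⟩ := sum_inv_quadratic (F := F) hx hxy hw
  have hterm : ∀ a ∈ Finset.univ.erase (1 / 4 : F),
      φ (∑ n ∈ Finset.Icc 1 N, C ((reversedDickson n k (1 : F)).eval a) * X ^ n) =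
        (1 - φ X ^ N) * (φ (C (2 - (k : F))) + φ (C ((k : F) - 1)) * φ X) *
          (1 - φ X + algebraMap F K a * φ X ^ 2)⁻¹ - (1 - φ X ^ N) * φ (C (2 - (k : F))) := by
    intro a ha
    have h := congrArg φ (sum_period_eq k (a := a) fun h =>
      Finset.ne_of_mem_erase ha (by rw [eq_div_iff h4, mul_comm, h]))
    simp only [map_mul φ, map_add φ, map_sub φ, map_pow φ, map_one φ, hC a, ← hq, ← hN] at h
    have := hw a
    apply mul_left_cancel₀ this
    rw [h]
    linear_combination -(1 - φ X ^ N) * (φ (C (2 - (k : F))) + φ (C ((k : F) - 1)) * φ X) *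
      mul_inv_cancel₀ this
  have hcard : ((q - 1 : ℕ) : K) = -1 := by
    have : (q : K) = 0 := by
      rw [← map_natCast (algebraMap F K), hq, FiniteField.cast_card_eq_zero, map_zero]
    rw [Nat.cast_sub Fintype.card_pos, this]
    simp
  have hk : φ (C ((k : F) - 1)) = 1 - φ (C (2 - (k : F))) := by
    rw [← map_one φ, ← map_sub, ← C_1, ← C_sub]
    congr 2
    ring
  have hG := congrArg φ (one_sub_X_mul_sum_pow (F := F) N)
  have hB := congrArg φ (one_sub_X_pow_mul_bPoly (F := F) k)
  have hM := congrArg φ (quarter_geom_sum (F := F))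
  have hW := congrArg φ ((pow_succ' (X - 1 : F[X]) (q - 1)).symm.trans
    ((congrArg _ hqr.symm).trans (sub_pow_card (F := F) X 1)))
  rw [map_mul φ _ (∑ a ∈ _, _), map_sum φ _ (Finset.univ.erase _), Finset.sum_congr rfl hterm,
    Finset.sum_sub_distrib, ← Finset.mul_sum, Finset.sum_erase_eq_sub (Finset.mem_univ _), hS,
    Finset.sum_const, Finset.card_erase_of_mem (Finset.mem_univ _), Finset.card_univ, ← hq,
    nsmul_eq_mul, hcard, cPoly]
  have hu := hw (1 / 4)
  simp only [map_mul φ, map_add φ, map_sub φ, map_neg φ, map_pow φ, map_one φ, one_pow,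
    ← hq, ← hN, hxy, hC (1 / 4), mul_comm 2 (q - 1), pow_mul] at hG hB hM hW ⊢
  rw [hk] at hB ⊢
  generalize φ (∑ i ∈ Finset.Icc 1 N, X ^ i) = G at *
  generalize φ (bPoly F q k) = B at *
  generalize φ (∑ m ∈ Finset.Icc 1 (q - 1), _) = M at *
  generalize φ (C (2 - (k : F))) = d at *
  generalize (φ X - 1) ^ (q - 1) = W at *
  generalize φ X ^ (q - 1) = y at *
  generalize φ X = x at *
  generalize algebraMap F K (1 / 4) = b at *
  generalize x ^ N = v at *
  obtain ⟨hy1, hA⟩ := mul_ne_zero_iff.1 hP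
  obtain rfl := eq_div_of_mul_eq hx1 ((mul_comm _ _).trans hG)
  obtain rfl := eq_div_of_mul_eq hy1 ((mul_comm _ _).trans hB)
  obtain rfl : W = (1 - x * y) / (1 - x) := eq_div_of_mul_eq hx1 (by linear_combination -hW)
  obtain rfl := eq_sub_of_add_eq (eq_div_of_mul_eq hu ((mul_comm _ _).trans hM))
  -- With `u = 1 - x + b x^2`, the identity rests on `M = (1+y-xy)(1-y)(1/u - 1/(1-x))`: the `1/u`
  -- part removes `a = 1/4`, and the `1/(1-x)` part combines with `d` to give `G`.
  rw [show x * y - y - 1 = -(1 + y - x * y) by ring]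
  clear hG hB hW hM hS hterm hw hP hxy
  generalize hUdef : 1 - x + b * x ^ 2 = u at *
  generalize hAdef : 1 + y - x * y = A at *
  generalize hsdef : 1 - x = s at *
  generalize hrdef : 1 - y = r at *
  field_simp
  subst hUdef hAdef hsdef hrdef
  ring

/-- The factorization `∑ c_i z^i = (z^q - z^(q-1) - 1) ∑ E_n z^n`, where `E_n` is the part of
`∑_a D_{n,k}(1, a)` with `a ≠ 1/4`. -/
theorem cPoly_eq [Fintype F] (h2 : (2 : F) ≠ 0) (k : ℕ) :
    cPoly F (Fintype.card F) k = (X ^ Fintype.card F - X ^ (Fintype.card F - 1) - 1) *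
      ∑ n ∈ Finset.Icc 1 (Fintype.card F ^ 2 - 1),
        C (dicksonSum F n k - ((k : F) * ((n : F) - 1) + 2) / 2 ^ n) * X ^ n := by
  classical
  have h4 : (4 : F) ≠ 0 := by
    have : (4 : F) = 2 * 2 := by norm_num
    rw [this]
    exact mul_ne_zero h2 h2
  have hsum : ∑ n ∈ Finset.Icc 1 (Fintype.card F ^ 2 - 1),
        C (dicksonSum F n k - ((k : F) * ((n : F) - 1) + 2) / 2 ^ n) * X ^ n =
      ∑ a ∈ Finset.univ.erase (1 / 4 : F),
        ∑ n ∈ Finset.Icc 1 (Fintype.card F ^ 2 - 1), C ((reversedDickson n k (1 : F)).eval a) * X ^ n := by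
    rw [Finset.sum_comm]
    refine Finset.sum_congr rfl fun n _ => ?_
    rw [← Finset.sum_mul, ← map_sum, Finset.sum_erase_eq_sub (Finset.mem_univ _),
      eval_reversedDickson_quarter h2, dicksonSum]
  rw [hsum]
  exact IsFractionRing.injective F[X] (FractionRing F[X])
    (map_cPoly_eq h4 k (algebraMap F[X] (FractionRing F[X]))
      (IsFractionRing.injective F[X] (FractionRing F[X]))
      fun a => (IsScalarTower.algebraMap_apply F F[X] (FractionRing F[X]) a).symm)

end FiniteField

/-! ### Comparison of coefficients. -/

section Coefficients

theorem coeff_sum_Icc_C_mul_X_pow {R : Type*} [CommRing R] (N : ℕ) (e : ℕ → R) (j : ℕ) :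
    (∑ n ∈ Finset.Icc 1 N, C (e n) * X ^ n).coeff j = if 1 ≤ j ∧ j ≤ N then e j else 0 := by
  simp only [finsetSum_coeff, coeff_C_mul_X_pow, Finset.sum_ite_eq, Finset.mem_Icc]

theorem three_le_card {F : Type*} [Field F] [Fintype F] (h2 : (2 : F) ≠ 0) :
    3 ≤ Fintype.card F := by
  by_contra h
  have hc : Fintype.card F = 2 := by
    have := Fintype.one_lt_card (α := F)
    omega
  exact h2 (by exact_mod_cast hc ▸ FiniteField.cast_card_eq_zero F)

theorem cCoeff_eq {F : Type*} [Field F] [Fintype F] (h2 : (2 : F) ≠ 0) (k : ℕ) (E : ℕ → F)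
    (hE : ∀ n, E n = if 1 ≤ n ∧ n ≤ Fintype.card F ^ 2 - 1 then
      dicksonSum F n k - ((k : F) * ((n : F) - 1) + 2) / 2 ^ n else 0) (j : ℕ) :
    cCoeff F (Fintype.card F) k j =
      (if Fintype.card F ≤ j then E (j - Fintype.card F) else 0) -
        (if Fintype.card F - 1 ≤ j then E (j - (Fintype.card F - 1)) else 0) - E j := by
  rw [cCoeff, cPoly_eq h2, sub_mul, sub_mul, one_mul, coeff_sub, coeff_sub, coeff_X_pow_mul',
    coeff_X_pow_mul']
  simp only [coeff_sum_Icc_C_mul_X_pow, hE]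

end Coefficients

theorem theoremT4p2 (F : Type*) [Field F] [Fintype F] (hF : ringChar F ≠ 2)
    (q : ℕ) (hq : Fintype.card F = q) (k : ℕ) :
    -- the `c_i` with `1 ≤ i ≤ q^2 + q - 1` are all the coefficients of the right-hand side
    (cPoly F q k = ∑ i ∈ Finset.Icc 1 (q ^ 2 + q - 1), C (cCoeff F q k i) * X ^ i) ∧
    (∀ j : ℕ, 1 ≤ j → j ≤ q - 1 →
      dicksonSum F j k = -cCoeff F q k j + ((k : F) * ((j : F) - 1) + 2) / 2 ^ j) ∧
    (dicksonSum F q k = cCoeff F q k 1 - cCoeff F q k q + (2 - (k : F)) / 2 ^ q) ∧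
    (∀ l j : ℕ, 1 ≤ l → l ≤ q - 2 → 1 ≤ j → j ≤ q - 1 →
      dicksonSum F (l * q + j) k =
        dicksonSum F ((l - 1) * q + j) k - dicksonSum F ((l - 1) * q + j + 1) k
          - cCoeff F q k (l * q + j)
          + (((k : F) * (j : F) + 2) * (1 - 2 ^ q + 2 ^ (q - 1)) + (k : F) * (2 ^ q - 1))
              / 2 ^ (l * q + j)) ∧
    (∀ l : ℕ, 2 ≤ l → l ≤ q - 2 →
      dicksonSum F (l * q) k =
        dicksonSum F ((l - 1) * q) k - dicksonSum F ((l - 1) * q + 1) k - cCoeff F q k (l * q)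
          + (((k : F) - 2) * (2 ^ q - 1) + 2 ^ q) / 2 ^ (l * q)) ∧
    (∀ j : ℕ, j ≤ q - 1 →
      dicksonSum F (q ^ 2 - q + j) k =
        (∑ i ∈ Finset.Icc j (q - 1), cCoeff F q k (q ^ 2 + i))
          + ((k : F) * ((j : F) - 1) + 2) / 2 ^ (q ^ 2 - q + j)) := by
  subst hq
  have h2 : (2 : F) ≠ 0 := Ring.two_ne_zero hF
  have hq3 := three_le_card h2
  have hq0 : ((Fintype.card F : ℕ) : F) = 0 := FiniteField.cast_card_eq_zero F
  have h2q : (2 : F) ^ Fintype.card F = 2 := FiniteField.pow_card 2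
  have h2q1 : (2 : F) ^ (Fintype.card F - 1) = 1 := FiniteField.pow_card_sub_one_eq_one 2 h2
  obtain ⟨E, hE⟩ : ∃ E : ℕ → F, ∀ n, E n = if 1 ≤ n ∧ n ≤ Fintype.card F ^ 2 - 1 then
      dicksonSum F n k - ((k : F) * ((n : F) - 1) + 2) / 2 ^ n else 0 := ⟨_, fun _ => rfl⟩
  have hc := cCoeff_eq h2 k E hE
  have hE0 : E 0 = 0 := by rw [hE, if_neg (by omega)]
  have hEtop : ∀ n, Fintype.card F ^ 2 ≤ n → E n = 0 := fun n hn => by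
    rw [hE, if_neg (by omega)]
  have hD : ∀ n, 1 ≤ n → n < Fintype.card F ^ 2 →
      dicksonSum F n k = E n + ((k : F) * ((n : F) - 1) + 2) / 2 ^ n := fun n h1 h2 => by
    rw [hE, if_pos (by omega), sub_add_cancel]
  generalize hqq : Fintype.card F = q at *
  have hqsq : q * 3 ≤ q ^ 2 := by rw [sq]; exact Nat.mul_le_mul_left _ hq3
  -- Since `q = 0` and `2^q = 2` in `F`, the three values at `1/4` collapse to `k / 2^(n+q)`; the
  -- numerators in identities 3 and 4 also reduce to `k`.
  have hrec : ∀ n, 1 ≤ n → n + q < q ^ 2 → dicksonSum F (n + q) k =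
      dicksonSum F n k - dicksonSum F (n + 1) k - cCoeff F q k (n + q) + k / 2 ^ (n + q) := by
    intro n hn1 hn2
    rw [hc, if_pos (by omega), if_pos (by omega), Nat.add_sub_cancel,
      show n + q - (q - 1) = n + 1 by omega, hD n hn1 (by omega), hD (n + 1) (by omega) (by omega),
      hD (n + q) (by omega) hn2, pow_add, h2q, pow_succ]
    push_cast
    rw [hq0]
    field_simp
    ring
  refine ⟨?_, ?_, ?_, ?_, ?_, ?_⟩
  · ext j
    rw [coeff_sum_Icc_C_mul_X_pow]
    split_ifs with h
    · rfl
    · change cCoeff F q k j = 0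
      rw [hc]
      by_cases hj : j = 0
      · subst hj
        rw [if_neg (by omega), if_neg (by omega), hE0]
        ring
      · rw [hEtop j (by omega), hEtop (j - q) (by omega), hEtop (j - (q - 1)) (by omega)]
        simp
  · intro j hj1 hj2
    rw [hD j hj1 (by omega), hc, if_neg (by omega)]
    -- Only `j = q - 1` meets this condition, and it picks out `E 0 = 0`.
    have : (if q - 1 ≤ j then E (j - (q - 1)) else 0) = 0 := by
      split_ifs
      · rw [show j - (q - 1) = 0 by omega, hE0]
      · rfl
    rw [this]
    ring
  · rw [hD q (by omega) (by omega), hc, hc, if_neg (by omega), if_neg (by omega), if_pos le_rfl,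
      if_pos (by omega), Nat.sub_self, hE0, show q - (q - 1) = 1 by omega, hq0]
    ring
  · intro l j hl1 hl2 hj1 hj2
    obtain ⟨m, rfl⟩ : ∃ m, l = m + 1 := ⟨l - 1, by omega⟩
    have hm : (m + 3) * q ≤ q ^ 2 := by
      rw [sq]
      exact Nat.mul_le_mul_right _ (by omega)
    have e : (m + 1) * q + j = m * q + j + q := by ring
    rw [Nat.add_sub_cancel, e, hrec _ (by omega) (by
      have : j < q := by omega
      linarith), h2q, h2q1]
    ring
  · intro l hl1 hl2
    obtain ⟨m, rfl⟩ : ∃ m, l = m + 1 := ⟨l - 1, by omega⟩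
    have hm : (m + 3) * q ≤ q ^ 2 := by
      rw [sq]
      exact Nat.mul_le_mul_right _ (by omega)
    -- `l ≥ 2` keeps the lower index positive; `l = 1` would involve `E 0`, which is not the `n = 0`
    -- case of `hD`.
    have hm1 : 1 * 1 ≤ m * q := Nat.mul_le_mul (by omega) (by omega)
    rw [Nat.add_sub_cancel, add_one_mul, hrec _ (by omega) (by linarith), h2q]
    ring
  · intro j hj
    have hcast : ((q ^ 2 - q + j : ℕ) : F) = j := by
      rw [Nat.cast_add, Nat.cast_sub (by omega), Nat.cast_pow, hq0]
      ring
    -- From index `q^2` on, the term `E (q^2 + i)` vanishes, so the sum telescopes and its far end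
    -- is `E (q^2) = 0`.
    have hsum : ∑ i ∈ Finset.Icc j (q - 1), cCoeff F q k (q ^ 2 + i) = E (q ^ 2 - q + j) := by
      have hI : Finset.Icc j (q - 1) = Finset.Ico j q := by
        ext i
        simp only [Finset.mem_Icc, Finset.mem_Ico]
        omega
      have hterm : ∀ i, cCoeff F q k (q ^ 2 + i) =
          E (q ^ 2 - q + i) - E (q ^ 2 - q + (i + 1)) := by
        intro i
        rw [hc, if_pos (by omega), if_pos (by omega), hEtop (q ^ 2 + i) (by omega), sub_zero,
          show q ^ 2 + i - q = q ^ 2 - q + i by omega,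
          show q ^ 2 + i - (q - 1) = q ^ 2 - q + (i + 1) by omega]
      rw [hI]
      simp only [hterm]
      rw [Finset.sum_Ico_eq_sub _ (by omega), Finset.sum_range_sub' (fun i => E (q ^ 2 - q + i)),
        Finset.sum_range_sub' (fun i => E (q ^ 2 - q + i)), hEtop (q ^ 2 - q + q) (by omega)]
      ring
    rw [hsum, hD _ (by omega) (by omega), hcast]
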